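/- Let $M$ be a smooth (Hausdorff) manifold of dimension $2n+1$ carrying a Kenmotsu structure $(\phi,\xi,\eta,g)$. That is, $g$ is a Riemannian metric, $\phi$ a $(1,1)$-tensor field, $\xi$ a vector field and $\eta$ a $1$-form, all smooth, such that $$\phi^2=-I+\eta\otimes\xi,\quad \eta(\xi)=1,\quad \eta=g(\xi,\cdot),\quad g(\phi\,\cdot,\phi\,\cdot)=g-\eta\otimes\eta,$$ and the Levi-Civita connection $\nabla$ of $g$ satisfies $(\nabla_X\phi)Y=g(\phi X,Y)\xi-\eta(Y)\phi X$ for all smooth vector fields $X,Y$. Let $a>0$ be a real constant and let $$\overline\phi=\phi,\quad \overline\xi=\tfrac1a\xi,\quad \overline\eta=a\eta,\quad \overline g=ag+a(a-1)\eta\otimes\eta$$ be the $D$-homothetically deformed structure, which is again an almost contact metric structure. Write $\overline\nabla$, $\overline{\mathrm{div}}$, $\overline{\mathrm{grad}}$, $\overline{\mathrm{Hess}}$, $\overline\Delta$ for the Levi-Civita connection, divergence, gradient, Hessian and Laplace operator of $\overline g$, and $\mathrm{div}$, $\mathrm{grad}$, $\mathrm{Hess}$, $\Delta$ for those of $g$,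 where $\mathrm{div}\,V=\mathrm{tr}(\nabla V)$, $g(\mathrm{grad} f,\cdot)=df$, $\mathrm{Hess}(f)(X,Y)=g(\nabla_X\mathrm{grad} f,Y)$ and $\Delta f=\mathrm{div}(\mathrm{grad} f)$. Then, for all smooth vector fields $X,Y$, $$(\overline\nabla_X\overline\phi)Y=\tfrac1a g(\phi X,Y)\xi-\eta(Y)\phi X,\qquad \overline\nabla\,\overline\xi=\tfrac1a(I-\eta\otimes\xi),$$ $$\pounds_{\overline\xi}\,\overline g=2(g-\eta\otimes\eta),\qquad \overline{\mathrm{div}}(\overline\xi)=\tfrac{2n}{a}.$$ Moreover, for every smooth function $f$ on $M$ and every smooth vector field $V$ on $M$, $$\overline{\mathrm{Hess}}(f)=\mathrm{Hess}(f)-\tfrac{a-1}{a}\,\xi(f)\,(g-\eta\otimes\eta),$$ $$\overline{\mathrm{grad}}(f)=\tfrac1a\,\mathrm{grad}(f)-\tfrac{a-1}{a^2}\,\xi(f)\,\xi,\qquad \overline{\mathrm{div}}(V)=\mathrm{div}(V),$$ $$\overline\Delta(f)=\tfrac1a\Delta(f)-\tfrac{2n(a-1)}{a^2}\,\xi(f)-\tfrac{a-1}{a^2}\,\xi(\xi(f)).$$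 -/

import Mathlib

open Bundle VectorField
open scoped Manifold ContDiff

noncomputable section

set_option linter.unusedSectionVars false

namespace ContactGeom

variable {E : Type*} [NormedAddCommGroup E] [NormedSpace ℝ E]
  {H : Type*} [TopologicalSpace H] {I : ModelWithCorners ℝ E H}
  {M : Type*} [TopologicalSpace M] [ChartedSpace H M] [IsManifold I ∞ M]

variable (I M) in
/-- Smooth Riemannian metrics on `M`. -/
abbrev RiemMetric := ContMDiffRiemannianMetric I ∞ E (TangentSpace I : M → Type _)

/-- The (twice) Koszul expression whose value is `2 g(∇_X Y, Z)`. -/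
def koszul (g : RiemMetric I M) (X Y Z : Π x : M, TangentSpace I x) (x : M) : ℝ :=
  mvfderiv I (fun y ↦ g.inner y (Y y) (Z y)) x (X x)
    + mvfderiv I (fun y ↦ g.inner y (X y) (Z y)) x (Y x)
    - mvfderiv I (fun y ↦ g.inner y (X y) (Y y)) x (Z x)
    + g.inner x (mlieBracket I X Y x) (Z x)
    - g.inner x (mlieBracket I X Z x) (Y x)
    - g.inner x (mlieBracket I Y Z x) (X x)

theorem mdiffAt_inner (g : RiemMetric I M) {X Y : Π x : M, TangentSpace I x} {x : M}
    (hX : MDiffAt (T% X) x) (hY : MDiffAt (T% Y) x) :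
    MDiffAt (fun y ↦ g.inner y (X y) (Y y)) x := by
  have h : MDifferentiableAt I (I.prod 𝓘(ℝ))
      (fun m ↦ TotalSpace.mk' ℝ (E := Bundle.Trivial M ℝ) m (g.inner m (X m) (Y m))) x :=
    MDifferentiableAt.clm_bundle_apply₂ (F₁ := E) (F₂ := E)
      (g.contMDiff.mdifferentiableAt (by simp)) hX hY
  simp only [mdifferentiableAt_totalSpace] at h
  exact h.2

variable [FiniteDimensional ℝ E]

theorem koszul_tensorial_left (g : RiemMetric I M) {Y Z : Π x : M, TangentSpace I x} {x : M}
    (hY : MDiffAt (T% Y) x) (hZ : MDiffAt (T% Z) x) :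
    TensorialAt I E (fun X ↦ koszul g X Y Z x) x where
  smul {f X} hf hX := by
    have h1 := mvfderiv_fun_mul hf (mdiffAt_inner g hX hZ)
    have h2 := mvfderiv_fun_mul hf (mdiffAt_inner g hX hY)
    simp [koszul, mlieBracket_smul_left hf hX, h1, h2]
    ring
  add {X X'} hX hX' := by
    have h1 := mvfderiv_fun_add (mdiffAt_inner g hX hZ) (mdiffAt_inner g hX' hZ)
    have h2 := mvfderiv_fun_add (mdiffAt_inner g hX hY) (mdiffAt_inner g hX' hY)
    simp [koszul, mlieBracket_add_left hX hX', h1, h2]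
    ring

theorem koszul_tensorial_right (g : RiemMetric I M) {X Y : Π x : M, TangentSpace I x} {x : M}
    (hX : MDiffAt (T% X) x) (hY : MDiffAt (T% Y) x) :
    TensorialAt I E (fun Z ↦ koszul g X Y Z x) x where
  smul {f Z} hf hZ := by
    have h1 := mvfderiv_fun_mul hf (mdiffAt_inner g hY hZ)
    have h2 := mvfderiv_fun_mul hf (mdiffAt_inner g hX hZ)
    simp [koszul, mlieBracket_smul_right hf hZ, h1, h2, g.symm x (Z x)]
    ring
  add {Z Z'} hZ hZ' := by
    have h1 := mvfderiv_fun_add (mdiffAt_inner g hY hZ) (mdiffAt_inner g hY hZ')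
    have h2 := mvfderiv_fun_add (mdiffAt_inner g hX hZ) (mdiffAt_inner g hX hZ')
    simp [koszul, mlieBracket_add_right hZ hZ', h1, h2]
    ring

instance tangentSpace_finiteDimensional (x : M) : FiniteDimensional ℝ (TangentSpace I x) :=
  inferInstanceAs (FiniteDimensional ℝ E)

instance tangentSpace_t2Space (x : M) : T2Space (TangentSpace I x) :=
  inferInstanceAs (T2Space E)

/-- The musical isomorphism `♭ : T_x M ≃ T_x^* M`, `v ↦ g(v, ·)`. -/
def flat (g : RiemMetric I M) (x : M) :
    TangentSpace I x ≃L[ℝ] (TangentSpace I x →L[ℝ] ℝ) :=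
  (LinearEquiv.ofInjectiveOfFinrankEq (g.inner x : TangentSpace I x →ₗ[ℝ] _)
    (by
      rw [injective_iff_map_eq_zero]
      intro v hv
      by_contra hne
      have h := g.pos x v hne
      have h' : g.inner x v = 0 := hv
      simp [h'] at h)
    (by
      rw [← LinearEquiv.finrank_eq
        (LinearMap.toContinuousLinearMap (𝕜 := ℝ) (E := TangentSpace I x) (F' := ℝ))]
      exact (Subspace.dual_finrank_eq (K := ℝ) (V := TangentSpace I x)).symm)
    ).toContinuousLinearEquiv

theorem flat_apply (g : RiemMetric I M) (x : M) (v w : TangentSpace I x) :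
    flat g x v w = g.inner x v w := rfl

theorem inner_flat_symm (g : RiemMetric I M) (x : M) (α : TangentSpace I x →L[ℝ] ℝ)
    (w : TangentSpace I x) : g.inner x ((flat g x).symm α) w = α w := by
  rw [← flat_apply, ContinuousLinearEquiv.apply_symm_apply]

theorem eq_of_inner (g : RiemMetric I M) {x : M} {v v' : TangentSpace I x}
    (h : ∀ Z : Π x : M, TangentSpace I x, MDiffAt (T% Z) x →
      g.inner x v (Z x) = g.inner x v' (Z x)) : v = v' := by
  apply (flat g x).injective
  ext w
  have := h (FiberBundle.extend E w) (FiberBundle.mdifferentiableAt_extend ..)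
  simpa [flat_apply] using this

open Classical in
/-- `∇_v Y` at `x`, determined by the Koszul formula `2 g(∇_X Y, Z) = koszul g X Y Z`
(and set to `0` where `Y` is not differentiable). -/
def leviCivitaFun (g : RiemMetric I M) (Y : Π x : M, TangentSpace I x) (x : M) :
    TangentSpace I x →L[ℝ] TangentSpace I x :=
  if hY : MDiffAt (T% Y) x then
    (1 / 2 : ℝ) • ((flat g x).symm : (TangentSpace I x →L[ℝ] ℝ) →L[ℝ] TangentSpace I x) ∘L
      TensorialAt.mkHom₂ (I := I) (F := E) (F' := E) (fun X Z ↦ koszul g X Y Z x) x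
        (fun _ hZ ↦ koszul_tensorial_left g hY hZ) (fun _ hX ↦ koszul_tensorial_right g hX hY)
  else 0

theorem inner_leviCivitaFun (g : RiemMetric I M) {X Y Z : Π x : M, TangentSpace I x} {x : M}
    (hX : MDiffAt (T% X) x) (hY : MDiffAt (T% Y) x) (hZ : MDiffAt (T% Z) x) :
    g.inner x (leviCivitaFun g Y x (X x)) (Z x) = 1 / 2 * koszul g X Y Z x := by
  have h := TensorialAt.mkHom₂_apply (I := I) (F := E) (F' := E)
    (Φ := fun X Z ↦ koszul g X Y Z x)
    (fun _ hZ ↦ koszul_tensorial_left g hY hZ) (fun _ hX ↦ koszul_tensorial_right g hX hY) hX hZ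
  simp [leviCivitaFun, hY, inner_flat_symm, h]

theorem koszul_add_middle (g : RiemMetric I M) {X Y Y' Z : Π x : M, TangentSpace I x} {x : M}
    (hX : MDiffAt (T% X) x) (hY : MDiffAt (T% Y) x) (hY' : MDiffAt (T% Y') x)
    (hZ : MDiffAt (T% Z) x) :
    koszul g X (Y + Y') Z x = koszul g X Y Z x + koszul g X Y' Z x := by
  have h1 := mvfderiv_fun_add (mdiffAt_inner g hY hZ) (mdiffAt_inner g hY' hZ)
  have h2 := mvfderiv_fun_add (mdiffAt_inner g hX hY) (mdiffAt_inner g hX hY')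
  simp [koszul, mlieBracket_add_right hY hY', mlieBracket_add_left hY hY', h1, h2]
  ring

theorem koszul_smul_middle (g : RiemMetric I M) {X Y Z : Π x : M, TangentSpace I x} {x : M}
    {f : M → ℝ} (hf : MDiffAt f x)
    (hX : MDiffAt (T% X) x) (hY : MDiffAt (T% Y) x) (hZ : MDiffAt (T% Z) x) :
    koszul g X (f • Y) Z x =
      f x * koszul g X Y Z x + 2 * (mvfderiv I f x (X x) * g.inner x (Y x) (Z x)) := by
  have h1 := mvfderiv_fun_mul hf (mdiffAt_inner g hY hZ)
  have h2 := mvfderiv_fun_mul hf (mdiffAt_inner g hX hY)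
  simp [koszul, mlieBracket_smul_right hf hY, mlieBracket_smul_left hf hY, h1, h2,
    g.symm x (Y x) (X x)]
  ring

/-- The Levi-Civita connection of `g`; `leviCivita g Y x v` is `∇_v Y` at `x`. -/
def leviCivita (g : RiemMetric I M) : CovariantDerivative I E (TangentSpace I : M → Type _) where
  toFun := leviCivitaFun g
  isCovariantDerivativeOnUniv :=
    { add := by
        intro Y Y' x hY hY' _
        have hs : MDiffAt (T% (Y + Y')) x := mdifferentiableAt_add_section hY hY'
        ext v
        refine eq_of_inner g fun Z hZ ↦ ?_
        have hv : v = FiberBundle.extend E v x := by simp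
        have hX := FiberBundle.mdifferentiableAt_extend I E v
        rw [hv, _root_.add_apply, map_add, _root_.add_apply,
          inner_leviCivitaFun g hX hs hZ, inner_leviCivitaFun g hX hY hZ,
          inner_leviCivitaFun g hX hY' hZ, koszul_add_middle g hX hY hY' hZ]
        ring
      leibniz := by
        intro Y f x hY hf _
        have hs : MDiffAt (T% (f • Y)) x := hf.smul_section hY
        ext v
        refine eq_of_inner g fun Z hZ ↦ ?_
        have hv : v = FiberBundle.extend E v x := by simp
        have hX := FiberBundle.mdifferentiableAt_extend I E v
        rw [hv, inner_leviCivitaFun g hX hs hZ, koszul_smul_middle g hf hX hY hZ]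
        simp only [_root_.add_apply, _root_.smul_apply, map_add, map_smul,
          ContinuousLinearMap.smulRight_apply, smul_eq_mul]
        rw [inner_leviCivitaFun g hX hY hZ]
        ring }

/-- The Levi-Civita connection is compatible with the metric. -/
theorem leviCivita_metric (g : RiemMetric I M) {X Y Z : Π x : M, TangentSpace I x} {x : M}
    (hX : MDiffAt (T% X) x) (hY : MDiffAt (T% Y) x) (hZ : MDiffAt (T% Z) x) :
    mvfderiv I (fun y ↦ g.inner y (Y y) (Z y)) x (X x) =
      g.inner x (leviCivita g Y x (X x)) (Z x) + g.inner x (Y x) (leviCivita g Z x (X x)) := by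
  have e1 : g.inner x (leviCivita g Y x (X x)) (Z x) = _ := inner_leviCivitaFun g hX hY hZ
  have e2 : g.inner x (leviCivita g Z x (X x)) (Y x) = _ := inner_leviCivitaFun g hX hZ hY
  have e3 : (fun y ↦ g.inner y (Y y) (Z y)) = (fun y ↦ g.inner y (Z y) (Y y)) :=
    funext fun y ↦ g.symm y _ _
  rw [g.symm x (Y x), e1, e2, koszul, koszul, e3, mlieBracket_swap_apply (V := Z) (W := Y)]
  simp
  ring

/-- The Levi-Civita connection is torsion-free. -/
theorem leviCivita_torsion (g : RiemMetric I M) : (leviCivita g).torsion = 0 := by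
  rw [CovariantDerivative.torsion_eq_zero_iff]
  intro X Y x hX hY
  refine eq_of_inner g fun Z hZ ↦ ?_
  have e1 : g.inner x (leviCivita g Y x (X x)) (Z x) = _ := inner_leviCivitaFun g hX hY hZ
  have e2 : g.inner x (leviCivita g X x (Y x)) (Z x) = _ := inner_leviCivitaFun g hY hX hZ
  have e3 : (fun y ↦ g.inner y (Y y) (X y)) = (fun y ↦ g.inner y (X y) (Y y)) :=
    funext fun y ↦ g.symm y _ _
  rw [map_sub, _root_.sub_apply, e1, e2, koszul, koszul, e3,
    mlieBracket_swap_apply (V := Y) (W := X)]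
  simp
  ring

/-- The directional derivative `X(f)`. -/
def dirDeriv (X : Π x : M, TangentSpace I x) (f : M → ℝ) (x : M) : ℝ :=
  mvfderiv I f x (X x)

/-- `((∇_X φ) Y)_x = (∇_X (φ Y))_x - φ (∇_X Y)_x`, for a `(1,1)`-tensor field `φ` and the
Levi-Civita connection `∇` of `g`. -/
def covDerivEnd (g : RiemMetric I M) (φ : Π x : M, TangentSpace I x →L[ℝ] TangentSpace I x)
    (X Y : Π x : M, TangentSpace I x) (x : M) : TangentSpace I x :=
  leviCivita g (fun y ↦ φ y (Y y)) x (X x) - φ x (leviCivita g Y x (X x))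

/-- The Lie derivative of the metric:
`(£_V g)(X, Y) = V(g(X, Y)) - g([V, X], Y) - g(X, [V, Y])`. -/
def lieDerivMetric (g : RiemMetric I M) (V X Y : Π x : M, TangentSpace I x) (x : M) : ℝ :=
  dirDeriv V (fun y ↦ g.inner y (X y) (Y y)) x
    - g.inner x (mlieBracket I V X x) (Y x) - g.inner x (X x) (mlieBracket I V Y x)

/-- The divergence `div V = tr(v ↦ ∇_v V)`. -/
def divergence (g : RiemMetric I M) (V : Π x : M, TangentSpace I x) (x : M) : ℝ :=
  LinearMap.trace ℝ (TangentSpace I x) (leviCivita g V x).toLinearMap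

/-- The gradient, `g(grad f, v) = df(v)`. -/
def grad (g : RiemMetric I M) (f : M → ℝ) (x : M) : TangentSpace I x :=
  (flat g x).symm (mvfderiv I f x)

/-- The Hessian `Hess f (v, w) = g(∇_v grad f, w)`. -/
def hessian (g : RiemMetric I M) (f : M → ℝ) (x : M) (v w : TangentSpace I x) : ℝ :=
  g.inner x (leviCivita g (grad g f) x v) w

/-- The Laplace operator `Δ f = div (grad f)`. -/
def laplacian (g : RiemMetric I M) (f : M → ℝ) (x : M) : ℝ :=
  divergence g (grad g f) x

variable (I M) in
/-- Smooth vector fields on `M`. -/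
abbrev VField := Cₛ^∞⟮I; E, (TangentSpace I : M → Type _)⟯

variable (I M) in
/-- Smooth `1`-forms on `M`. -/
abbrev OneForm := Cₛ^∞⟮I; E →L[ℝ] ℝ, fun x : M ↦ TangentSpace I x →L[ℝ] ℝ⟯

variable (I M) in
/-- Smooth `(1,1)`-tensor fields on `M`. -/
abbrev EndField := Cₛ^∞⟮I; E →L[ℝ] E, fun x : M ↦ TangentSpace I x →L[ℝ] TangentSpace I x⟯

variable (I M) in
/-- An almost contact metric structure `(φ, ξ, η, g)` on `M`. -/
structure AlmostContactMetric where
  φ : EndField I M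
  ξ : VField I M
  η : OneForm I M
  g : RiemMetric I M
  φ_φ (x : M) (v : TangentSpace I x) : φ x (φ x v) = -v + η x v • ξ x
  η_ξ (x : M) : η x (ξ x) = 1
  η_eq (x : M) (v : TangentSpace I x) : η x v = g.inner x (ξ x) v
  g_φ (x : M) (v w : TangentSpace I x) :
    g.inner x (φ x v) (φ x w) = g.inner x v w - η x v * η x w

namespace AlmostContactMetric

/-- The Kenmotsu condition `(∇_X φ) Y = g(φ X, Y) ξ - η(Y) φ X`. -/
def IsKenmotsu (S : AlmostContactMetric I M) : Prop :=
  ∀ (X Y : VField I M) (x : M),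
    covDerivEnd S.g S.φ X Y x =
      S.g.inner x (S.φ x (X x)) (Y x) • S.ξ x - S.η x (Y x) • S.φ x (X x)

theorem φ_ξ (S : AlmostContactMetric I M) (x : M) : S.φ x (S.ξ x) = 0 := by
  by_contra h
  have h1 := S.g.pos x _ h
  rw [S.g_φ, S.η_ξ, ← S.η_eq, S.η_ξ] at h1
  norm_num at h1

theorem η_φ (S : AlmostContactMetric I M) (x : M) (v : TangentSpace I x) :
    S.η x (S.φ x v) = 0 := by
  have h := S.φ_φ x (S.φ x v)
  rw [S.φ_φ x v, map_add, map_neg, map_smul, φ_ξ, smul_zero, add_zero] at h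
  have h2 := congrArg (fun w ↦ S.η x w) h
  simp [S.η_ξ] at h2
  exact h2

theorem η_sq_le (S : AlmostContactMetric I M) (x : M) (v : TangentSpace I x) :
    S.η x v * S.η x v ≤ S.g.inner x v v := by
  have h := S.g_φ x v v
  by_cases h0 : S.φ x v = 0
  · simp [h0] at h
    linarith
  · have := S.g.pos x _ h0
    linarith

/-- The bilinear form `a g + a (a - 1) η ⊗ η` on `T_x M`. -/
def deformInner (S : AlmostContactMetric I M) (a : ℝ) (x : M) :
    TangentSpace I x →L[ℝ] TangentSpace I x →L[ℝ] ℝ :=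
  a • S.g.inner x + (a * (a - 1)) •
    (S.η x).smulRight (S.η x)

theorem deformInner_apply (S : AlmostContactMetric I M) (a : ℝ) (x : M) (v w : TangentSpace I x) :
    S.deformInner a x v w =
      a * S.g.inner x v w + a * (a - 1) * (S.η x v * S.η x w) := by
  simp [deformInner]

theorem le_deformInner (S : AlmostContactMetric I M) {a : ℝ} (ha : 0 < a) (x : M)
    (v : TangentSpace I x) :
    min a (a ^ 2) * S.g.inner x v v ≤ S.deformInner a x v v := by
  rw [deformInner_apply]
  have h := S.η_sq_le x v
  have h0 := mul_self_nonneg (S.η x v)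
  set e : ℝ := S.η x v * S.η x v
  rcases le_total 1 a with h1 | h1
  · have : min a (a ^ 2) ≤ a := min_le_left _ _
    have h2 : 0 ≤ a * (a - 1) := by nlinarith
    nlinarith [mul_nonneg h2 h0]
  · have : min a (a ^ 2) ≤ a ^ 2 := min_le_right _ _
    have h2 : 0 ≤ a * (1 - a) := by nlinarith
    nlinarith [mul_nonneg h2 (sub_nonneg.2 h)]

theorem contMDiff_deformInner (S : AlmostContactMetric I M) (a : ℝ) :
    ContMDiff I (I.prod 𝓘(ℝ, E →L[ℝ] E →L[ℝ] ℝ)) ∞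
      (fun x ↦ TotalSpace.mk' (E →L[ℝ] E →L[ℝ] ℝ) x (S.deformInner a x)) := by
  have h : ContMDiff I (I.prod 𝓘(ℝ, E →L[ℝ] E →L[ℝ] ℝ)) ∞
      (fun x ↦ TotalSpace.mk' (E →L[ℝ] E →L[ℝ] ℝ)
        (E := fun x : M ↦ TangentSpace I x →L[ℝ] TangentSpace I x →L[ℝ] ℝ) x
        ((S.η x).smulRight (S.η x))) := by
    intro x₀
    have hη := ((contMDiffAt_hom_bundle _).1 (S.η.contMDiff x₀)).2
    refine (contMDiffAt_hom_bundle _).2 ⟨contMDiffAt_id, ?_⟩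
    have hc : ContDiff ℝ ∞ (fun L : E →L[ℝ] ℝ ↦ L.smulRight L) :=
      contDiff_id.smulRight contDiff_id
    refine (hc.contMDiff.contMDiffAt.comp x₀ hη).congr_of_eventuallyEq ?_
    have hb : ∀ᶠ x in nhds x₀, x ∈ (trivializationAt E (TangentSpace I) x₀).baseSet :=
      (trivializationAt E (TangentSpace I) x₀).open_baseSet.mem_nhds
        (FiberBundle.mem_baseSet_trivializationAt' x₀)
    filter_upwards [hb] with x hx
    ext v w
    rw [inCoordinates_apply_eq₂ hx hx (by simp)]
    simp [ContinuousLinearMap.inCoordinates, Trivialization.symmL_apply _ hx]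
  exact (S.g.contMDiff.const_smul_section (a := a)).add_section
    (h.const_smul_section (a := a * (a - 1)))

/-- The deformed metric `a g + a (a - 1) η ⊗ η`. -/
def deformMetric (S : AlmostContactMetric I M) (a : ℝ) (ha : 0 < a) : RiemMetric I M where
  inner := S.deformInner a
  symm x v w := by
    rw [deformInner_apply, deformInner_apply, S.g.symm x v w]
    ring
  pos x v hv := lt_of_lt_of_le (mul_pos (lt_min ha (by positivity)) (S.g.pos x v hv))
    (S.le_deformInner ha x v)
  isVonNBounded x := by
    set c := min a (a ^ 2) with hc
    have hc0 : 0 < c := lt_min ha (by positivity)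
    have h := (S.g.isVonNBounded x).image
      ((Real.sqrt c)⁻¹ • ContinuousLinearMap.id ℝ (TangentSpace I x))
    refine h.subset ?_
    intro v hv
    refine ⟨Real.sqrt c • v, ?_, ?_⟩
    · have h1 := S.le_deformInner ha x v
      have h2 : S.deformInner a x v v < 1 := hv
      have h3 := Real.mul_self_sqrt hc0.le
      change S.g.inner x (Real.sqrt c • v) (Real.sqrt c • v) < 1
      simp only [map_smul, _root_.smul_apply, smul_eq_mul, ← mul_assoc, h3]
      linarith
    · simp [smul_smul, (Real.sqrt_pos.2 hc0).ne']
  contMDiff := S.contMDiff_deformInner a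

/-- The `D`-homothetic deformation
`φ' = φ`, `ξ' = (1/a) ξ`, `η' = a η`, `g' = a g + a (a - 1) η ⊗ η`. -/
def deform (S : AlmostContactMetric I M) (a : ℝ) (ha : 0 < a) : AlmostContactMetric I M where
  φ := S.φ
  ξ := (1 / a) • S.ξ
  η := a • S.η
  g := S.deformMetric a ha
  φ_φ x v := by
    change _ = -v + (a * S.η x v) • (1 / a) • S.ξ x
    rw [S.φ_φ, smul_smul]
    congr 2
    field_simp
  η_ξ x := by
    change a * S.η x ((1 / a) • S.ξ x) = 1
    rw [map_smul, S.η_ξ, smul_eq_mul]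
    field_simp
  η_eq x v := by
    change a * S.η x v = S.deformInner a x ((1 / a) • S.ξ x) v
    rw [map_smul, _root_.smul_apply, deformInner_apply, S.η_ξ, ← S.η_eq, smul_eq_mul]
    field_simp
    ring
  g_φ x v w := by
    change S.deformInner a x _ _ = S.deformInner a x _ _ - (a * S.η x v) * (a * S.η x w)
    rw [deformInner_apply, deformInner_apply, S.g_φ, η_φ]
    ring

end AlmostContactMetric

end ContactGeom
end

/-! Everything follows from one formula, `leviCivita_deform`: the two connections differ by the
rank-one term (a - 1)/a (g(X, Y) - η(X)η(Y)) ξ. Putting Y = ξ in the Kenmotsu condition gives ∇ξ = I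
- η ⊗ ξ. Hence ∇η = g - η ⊗ η is symmetric and η is closed. In the Koszul formula for the deformed
metric, closedness cancels every contribution of η ⊗ η except 2a(a - 1) X(η(Y)) η(Z), and X(η(Y)) =
η(∇_X Y) + g(X, Y) - η(X)η(Y) turns this into the stated correction.

The remaining identities are algebra with this formula, plus traces of rank-one maps. For Hessian
and Laplacian the Leibniz rule must be applied to the gradient, so the gradient has to be a
differentiable field (`mdiffAt_grad`); the connection takes the default value 0 elsewhere. The
Kenmotsu condition speaks of global smooth fields only, so tangent vectors are first extended to
such fields (`exists_vField_eq`); this is where Hausdorffness enters. -/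

namespace ContactGeom

variable {E : Type*} [NormedAddCommGroup E] [NormedSpace ℝ E] [FiniteDimensional ℝ E]
  {H : Type*} [TopologicalSpace H] {I : ModelWithCorners ℝ E H}
  {M : Type*} [TopologicalSpace M] [ChartedSpace H M] [IsManifold I ∞ M]

/-! ### Extension of vectors and differentiability of gradients -/

/-- On a Hausdorff manifold every tangent vector is the value of a smooth vector field. -/
theorem exists_vField_eq [T2Space M] {x : M} (v : TangentSpace I x) :
    ∃ X : VField I M, X x = v := by
  obtain ⟨s, hs, hsv⟩ := FiberBundle.exists_contMDiffOn_extend (k := ∞) I E v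
  obtain ⟨u, hus, hu, hxu⟩ := mem_nhds_iff.1 hs
  obtain ⟨ψ, -, hψ⟩ := (SmoothBumpFunction.nhds_basis_tsupport (I := I) x).mem_iff.1
    (hu.mem_nhds hxu)
  -- A local smooth extension is cut off by a bump function supported where it is smooth and equal
  -- to 1 at `x`.
  exact ⟨⟨(ψ : M → ℝ) • FiberBundle.extend E v,
    ContMDiffOn.smul_section_of_tsupport ψ.contMDiff.contMDiffOn hu hψ (hsv.mono hus)⟩,
    by simp⟩

theorem VField.mdiffAt (X : VField I M) (x : M) :
    MDifferentiableAt I (I.prod 𝓘(ℝ, E)) (fun y ↦ TotalSpace.mk' E y (X y)) x :=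
  (X.contMDiff x).mdifferentiableAt (by simp)

/-- The differential of a smooth function is a differentiable section of the cotangent bundle. -/
theorem mdiffAt_mvfderiv {f : M → ℝ} (hf : ContMDiff I 𝓘(ℝ) ∞ f) (x : M) :
    MDifferentiableAt I (I.prod 𝓘(ℝ, E →L[ℝ] ℝ))
      (fun y ↦ TotalSpace.mk' (E →L[ℝ] ℝ) (E := fun y : M ↦ TangentSpace I y →L[ℝ] ℝ) y
        (mvfderiv I f y)) x := by
  have h := ((hf x).mfderiv_const (m := 1) (by norm_cast)).mdifferentiableAt
    one_ne_zero
  refine (mdifferentiableAt_hom_bundle _).2 ⟨mdifferentiableAt_id, ?_⟩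
  convert h using 1
  funext y
  ext v
  simp [ContinuousLinearMap.inCoordinates, inTangentCoordinates, mvfderiv]
  rfl

/-- The inverse of the musical isomorphism is a differentiable bundle map. -/
theorem mdiffAt_flat_symm (g : RiemMetric I M) {α : Π x : M, TangentSpace I x →L[ℝ] ℝ} {x : M}
    (hα : MDifferentiableAt I (I.prod 𝓘(ℝ, E →L[ℝ] ℝ))
      (fun y ↦ TotalSpace.mk' (E →L[ℝ] ℝ) (E := fun y : M ↦ TangentSpace I y →L[ℝ] ℝ) y
        (α y)) x) :
    MDiffAt (T% (fun y ↦ (flat g y).symm (α y))) x := by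
  have hg := ((mdifferentiableAt_hom_bundle _).1
    ((g.contMDiff x).mdifferentiableAt (by simp))).2
  have hb : x ∈ (trivializationAt E (TangentSpace I) x).baseSet :=
    FiberBundle.mem_baseSet_trivializationAt' x
  have hb' : x ∈ (trivializationAt (E →L[ℝ] ℝ)
      (fun y : M ↦ TangentSpace I y →L[ℝ] ℝ) x).baseSet :=
    FiberBundle.mem_baseSet_trivializationAt' x
  -- In trivializations at `x`, `flat g y` is an invertible operator from E to its dual,
  -- differentiable in `y` at `x`. Its inverse represents `(flat g y).symm`, and operator inversion
  -- is differentiable at invertible operators.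
  let T (y : M) (h : y ∈ (trivializationAt E (TangentSpace I) x).baseSet)
      (h' : y ∈ (trivializationAt (E →L[ℝ] ℝ)
        (fun y : M ↦ TangentSpace I y →L[ℝ] ℝ) x).baseSet) : E ≃L[ℝ] (E →L[ℝ] ℝ) :=
    ((trivializationAt E (TangentSpace I) x).continuousLinearEquivAt ℝ y h).symm.trans
      ((flat g y).trans ((trivializationAt (E →L[ℝ] ℝ)
        (fun y : M ↦ TangentSpace I y →L[ℝ] ℝ) x).continuousLinearEquivAt ℝ y h'))
  have hT (y : M) (h) (h') : ContinuousLinearMap.inCoordinates E (TangentSpace I) (E →L[ℝ] ℝ)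
      (fun y : M ↦ TangentSpace I y →L[ℝ] ℝ) x y x y (g.inner y) = T y h h' := by
    rw [ContinuousLinearMap.inCoordinates_eq h h']
    rfl
  have hT' (y : M) (h) (h') : ContinuousLinearMap.inCoordinates (E →L[ℝ] ℝ)
      (fun y : M ↦ TangentSpace I y →L[ℝ] ℝ) E (TangentSpace I) x y x y
        ((flat g y).symm : (TangentSpace I y →L[ℝ] ℝ) →L[ℝ] TangentSpace I y)
        = (T y h h').symm := by
    rw [ContinuousLinearMap.inCoordinates_eq h' h]
    rfl
  have hinv : DifferentiableAt ℝ ContinuousLinearMap.inverse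
      (ContinuousLinearMap.inCoordinates E (TangentSpace I) (E →L[ℝ] ℝ)
        (fun y : M ↦ TangentSpace I y →L[ℝ] ℝ) x x x x (g.inner x)) := by
    rw [hT x hb hb']
    exact (contDiffAt_map_inverse (n := 1) (T x hb hb')).differentiableAt one_ne_zero
  refine MDifferentiableAt.clm_apply_of_inCoordinates (F₁ := E →L[ℝ] ℝ)
    (E₁ := fun y : M ↦ TangentSpace I y →L[ℝ] ℝ) (F₂ := E) (E₂ := (TangentSpace I : M → Type _))
    (b₁ := id) (b₂ := id)
    (ϕ := fun y ↦ ((flat g y).symm : (TangentSpace I y →L[ℝ] ℝ) →L[ℝ] TangentSpace I y))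
    (v := α) ?_ hα mdifferentiableAt_id
  refine (hinv.mdifferentiableAt.comp x hg).congr_of_eventuallyEq ?_
  filter_upwards [(trivializationAt E (TangentSpace I) x).open_baseSet.mem_nhds hb,
    (trivializationAt (E →L[ℝ] ℝ) (fun y : M ↦ TangentSpace I y →L[ℝ] ℝ)
      x).open_baseSet.mem_nhds hb'] with y h h'
  refine (hT' y h h').trans ?_
  simp only [Function.comp_apply]
  erw [hT y h h']
  rw [ContinuousLinearMap.inverse_equiv]

theorem mdiffAt_grad (g : RiemMetric I M) {f : M → ℝ} (hf : ContMDiff I 𝓘(ℝ) ∞ f) (x : M) :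
    MDiffAt (T% (grad g f)) x :=
  mdiffAt_flat_symm g (mdiffAt_mvfderiv hf x)

theorem inner_grad (g : RiemMetric I M) (f : M → ℝ) (x : M) (v : TangentSpace I x) :
    g.inner x (grad g f x) v = mvfderiv I f x v :=
  inner_flat_symm g x _ v

theorem dirDeriv_eq_inner_grad (g : RiemMetric I M) (X : Π x : M, TangentSpace I x) (f : M → ℝ) :
    dirDeriv X f = fun x ↦ g.inner x (grad g f x) (X x) :=
  funext fun x ↦ (inner_grad g f x (X x)).symm

/-! ### Consequences of metric compatibility and vanishing torsion -/

/-- Metric compatibility, in the direction of a tangent vector. -/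
theorem mvfderiv_inner (g : RiemMetric I M) {Y Z : Π x : M, TangentSpace I x} {x : M}
    (v : TangentSpace I x) (hY : MDiffAt (T% Y) x) (hZ : MDiffAt (T% Z) x) :
    mvfderiv I (fun y ↦ g.inner y (Y y) (Z y)) x v =
      g.inner x (leviCivita g Y x v) (Z x) + g.inner x (Y x) (leviCivita g Z x v) := by
  simpa using leviCivita_metric g (FiberBundle.mdifferentiableAt_extend I E v) hY hZ

theorem leviCivita_sub_eq_mlieBracket (g : RiemMetric I M) {X Y : Π x : M, TangentSpace I x}
    {x : M} (hX : MDiffAt (T% X) x) (hY : MDiffAt (T% Y) x) :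
    leviCivita g Y x (X x) - leviCivita g X x (Y x) = mlieBracket I X Y x :=
  (CovariantDerivative.torsion_eq_zero_iff _).1 (leviCivita_torsion g) hX hY

/-- The Lie derivative of the metric in terms of the Levi-Civita connection. -/
theorem lieDerivMetric_eq (g : RiemMetric I M) {V X Y : Π x : M, TangentSpace I x} {x : M}
    (hV : MDiffAt (T% V) x) (hX : MDiffAt (T% X) x) (hY : MDiffAt (T% Y) x) :
    lieDerivMetric g V X Y x =
      g.inner x (leviCivita g V x (X x)) (Y x) + g.inner x (X x) (leviCivita g V x (Y x)) := by
  rw [lieDerivMetric, dirDeriv, mvfderiv_inner g _ hX hY, ← leviCivita_sub_eq_mlieBracket g hV hX,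
    ← leviCivita_sub_eq_mlieBracket g hV hY]
  simp only [map_sub, _root_.sub_apply]
  ring

/-! ### Almost contact metric algebra -/

namespace AlmostContactMetric

variable {S : AlmostContactMetric I M}

theorem inner_ξ_right (S : AlmostContactMetric I M) (x : M) (v : TangentSpace I x) :
    S.g.inner x v (S.ξ x) = S.η x v := by
  rw [S.g.symm, S.η_eq]

/-- Replace v by φv in g(φv, φw) = g(v, w) - η(v)η(w) and expand φ²; the η-terms vanish because η ∘
φ = 0. -/
theorem inner_φ_right (S : AlmostContactMetric I M) (x : M) (v w : TangentSpace I x) :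
    S.g.inner x v (S.φ x w) = -S.g.inner x (S.φ x v) w := by
  have h := S.g_φ x (S.φ x v) w
  rw [S.φ_φ, S.η_φ] at h
  simp only [map_add, map_neg, map_smul, _root_.add_apply, _root_.neg_apply,
    _root_.smul_apply, ← S.η_eq, S.η_φ, smul_eq_mul] at h
  linarith

theorem deform_inner (S : AlmostContactMetric I M) {a : ℝ} (ha : 0 < a) (x : M)
    (v w : TangentSpace I x) :
    (S.deform a ha).g.inner x v w =
      a * S.g.inner x v w + a * (a - 1) * (S.η x v * S.η x w) :=
  S.deformInner_apply a x v w

theorem mdiffAt_η (S : AlmostContactMetric I M) {Y : Π x : M, TangentSpace I x} {x : M}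
    (hY : MDiffAt (T% Y) x) : MDiffAt (fun y ↦ S.η y (Y y)) x := by
  simpa only [S.η_eq] using mdiffAt_inner S.g (VField.mdiffAt S.ξ x) hY

theorem mdiffAt_φ (S : AlmostContactMetric I M) {Y : Π x : M, TangentSpace I x} {x : M}
    (hY : MDiffAt (T% Y) x) : MDiffAt (T% (fun y ↦ S.φ y (Y y))) x :=
  MDifferentiableAt.clm_bundle_apply (F₁ := E) (F₂ := E)
    ((S.φ.contMDiff x).mdifferentiableAt (by simp)) hY

/-! ### Derivatives of ξ and η on a Kenmotsu manifold -/

/-- `∇ξ = I - η ⊗ ξ` on a Kenmotsu manifold. -/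
theorem IsKenmotsu.leviCivita_ξ [T2Space M] (hS : S.IsKenmotsu) (x : M) (v : TangentSpace I x) :
    leviCivita S.g S.ξ x v = v - S.η x v • S.ξ x := by
  obtain ⟨X, rfl⟩ := exists_vField_eq v
  have h := hS X S.ξ x
  have h0 : (fun y ↦ S.φ y (S.ξ y)) = (0 : Π y : M, TangentSpace I y) :=
    funext fun y ↦ S.φ_ξ y
  -- φ determines a vector only up to its ξ-component. That component of ∇_X ξ is zero because ξ has
  -- constant length.
  have hη : S.η x (leviCivita S.g S.ξ x (X x)) = 0 := by
    have h1 := mvfderiv_inner S.g (X x) (VField.mdiffAt S.ξ x) (VField.mdiffAt S.ξ x)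
    have h2 : (fun y ↦ S.g.inner y (S.ξ y) (S.ξ y)) = fun _ ↦ (1 : ℝ) := by
      funext y
      rw [← S.η_eq, S.η_ξ]
    rw [h2, mvfderiv_const, S.inner_ξ_right, ← S.η_eq] at h1
    simp only [_root_.zero_apply] at h1
    linarith
  rw [covDerivEnd, h0, CovariantDerivative.zero, S.inner_ξ_right, S.η_φ, S.η_ξ] at h
  -- The condition now reads φ(∇_X ξ) = φX; a second φ recovers ∇_X ξ.
  have h3 := congrArg (S.φ x) h
  simp only [Pi.zero_apply, _root_.zero_apply, zero_sub, zero_smul, one_smul, map_neg, S.φ_φ,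
    hη, add_zero, neg_neg] at h3
  rw [h3]
  abel

/-- The derivative of `η(Y)` on a Kenmotsu manifold. -/
theorem IsKenmotsu.mvfderiv_η [T2Space M] (hS : S.IsKenmotsu) {Y : Π x : M, TangentSpace I x}
    {x : M} (v : TangentSpace I x) (hY : MDiffAt (T% Y) x) :
    mvfderiv I (fun y ↦ S.η y (Y y)) x v =
      S.g.inner x v (Y x) - S.η x v * S.η x (Y x) + S.η x (leviCivita S.g Y x v) := by
  have h := mvfderiv_inner S.g v (VField.mdiffAt S.ξ x) hY
  simp only [← S.η_eq] at h
  rw [h, hS.leviCivita_ξ]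
  simp [S.η_eq]

/-- The form `η` is closed on a Kenmotsu manifold. -/
theorem IsKenmotsu.η_mlieBracket [T2Space M] (hS : S.IsKenmotsu) {X Y : Π x : M, TangentSpace I x}
    {x : M} (hX : MDiffAt (T% X) x) (hY : MDiffAt (T% Y) x) :
    S.η x (mlieBracket I X Y x) = mvfderiv I (fun y ↦ S.η y (Y y)) x (X x) -
      mvfderiv I (fun y ↦ S.η y (X y)) x (Y x) := by
  rw [hS.mvfderiv_η _ hX, hS.mvfderiv_η _ hY, ← leviCivita_sub_eq_mlieBracket S.g hX hY, map_sub,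
    S.g.symm x (X x)]
  ring

/-! ### The deformed connection -/

theorem mvfderiv_deform_inner (S : AlmostContactMetric I M) {a : ℝ} (ha : 0 < a)
    {X Y : Π x : M, TangentSpace I x} {x : M} (v : TangentSpace I x)
    (hX : MDiffAt (T% X) x) (hY : MDiffAt (T% Y) x) :
    mvfderiv I (fun y ↦ (S.deform a ha).g.inner y (X y) (Y y)) x v =
      a * mvfderiv I (fun y ↦ S.g.inner y (X y) (Y y)) x v + a * (a - 1) *
        (S.η x (X x) * mvfderiv I (fun y ↦ S.η y (Y y)) x v +
          S.η x (Y x) * mvfderiv I (fun y ↦ S.η y (X y)) x v) := by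
  have hg := mdiffAt_inner S.g hX hY
  have h1 := S.mdiffAt_η hX
  have h2 := S.mdiffAt_η hY
  have h3 : MDiffAt (fun y ↦ S.η y (X y) * S.η y (Y y)) x := h1.mul h2
  have ha1 : MDiffAt (fun _ : M ↦ a) x := mdifferentiableAt_const
  have ha2 : MDiffAt (fun _ : M ↦ a * (a - 1)) x := mdifferentiableAt_const
  have e1 := mvfderiv_fun_mul ha1 hg
  have e2 := mvfderiv_fun_mul ha2 h3
  simp only [deform_inner]
  have e3 := mvfderiv_fun_add (ha1.mul hg) (ha2.mul h3)
  simp only [Pi.mul_apply] at e3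
  rw [e3]
  change (mvfderiv I (fun y ↦ a * S.g.inner y (X y) (Y y)) x +
    mvfderiv I (fun y ↦ a * (a - 1) * (S.η y (X y) * S.η y (Y y))) x) v = _
  rw [e1, e2, mvfderiv_fun_mul h1 h2]
  simp [mvfderiv_const]
  ring

/-- The Levi-Civita connection of the deformed metric:
`∇'_X Y = ∇_X Y + (a - 1) / a (g(X, Y) - η(X) η(Y)) ξ`. -/
theorem IsKenmotsu.leviCivita_deform [T2Space M] (hS : S.IsKenmotsu) {a : ℝ} (ha : 0 < a)
    {Y : Π x : M, TangentSpace I x} {x : M} (v : TangentSpace I x) (hY : MDiffAt (T% Y) x) :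
    leviCivita (S.deform a ha).g Y x v = leviCivita S.g Y x v +
      ((a - 1) / a * (S.g.inner x v (Y x) - S.η x v * S.η x (Y x))) • S.ξ x := by
  obtain ⟨X, rfl⟩ := exists_vField_eq v
  have hX := VField.mdiffAt X x
  refine eq_of_inner (S.deform a ha).g fun Z hZ ↦ ?_
  have e1 : (S.deform a ha).g.inner x (leviCivita (S.deform a ha).g Y x (X x)) (Z x) = _ :=
    inner_leviCivitaFun (S.deform a ha).g hX hY hZ
  have e2 : S.g.inner x (leviCivita S.g Y x (X x)) (Z x) = _ :=
    inner_leviCivitaFun S.g hX hY hZ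
  have e3 := hS.mvfderiv_η (X x) hY
  -- The factor a² = a + a(a - 1) turns the Koszul coefficient a(a - 1) into (a - 1)/a.
  have e4 : (S.deform a ha).g.inner x (S.ξ x) (Z x) = a ^ 2 * S.η x (Z x) := by
    rw [deform_inner, S.η_ξ, ← S.η_eq]
    ring
  rw [map_add, _root_.add_apply, map_smul, _root_.smul_apply, e4, e1, deform_inner, e2, koszul,
    koszul, S.mvfderiv_deform_inner ha _ hY hZ, S.mvfderiv_deform_inner ha _ hX hZ,
    S.mvfderiv_deform_inner ha _ hX hY, deform_inner, deform_inner, deform_inner,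
    hS.η_mlieBracket hX hY, hS.η_mlieBracket hX hZ, hS.η_mlieBracket hY hZ, e3, smul_eq_mul]
  field_simp
  ring

/-! ### The deformed structure tensors -/

/-- The correction to ∇_X Y is killed by φξ = 0; the one to ∇_X(φY) is -(a - 1)/a g(φX, Y) ξ by
skew-symmetry of φ, leaving the factor 1/a. -/
theorem IsKenmotsu.covDerivEnd_deform [T2Space M] (hS : S.IsKenmotsu) {a : ℝ} (ha : 0 < a)
    (X Y : VField I M) (x : M) :
    covDerivEnd (S.deform a ha).g (S.deform a ha).φ X Y x =
      ((1 / a) * S.g.inner x (S.φ x (X x)) (Y x)) • S.ξ x - S.η x (Y x) • S.φ x (X x) := by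
  have h := hS X Y x
  have hY := VField.mdiffAt Y x
  change leviCivita (S.deform a ha).g (fun y ↦ S.φ y (Y y)) x (X x) -
    S.φ x (leviCivita (S.deform a ha).g Y x (X x)) = _
  rw [hS.leviCivita_deform ha _ (S.mdiffAt_φ hY), hS.leviCivita_deform ha _ hY, map_add, map_smul,
    S.φ_ξ, smul_zero, add_zero, add_sub_right_comm]
  change covDerivEnd S.g S.φ X Y x + _ = _
  rw [h, S.η_φ, S.inner_φ_right]
  match_scalars
  · field_simp
    ring
  · ring

/-- The correction vanishes at Y = ξ, since g(X, ξ) = η(X). -/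
theorem IsKenmotsu.leviCivita_deform_ξ [T2Space M] (hS : S.IsKenmotsu) {a : ℝ} (ha : 0 < a)
    (x : M) (v : TangentSpace I x) :
    leviCivita (S.deform a ha).g S.ξ x v = v - S.η x v • S.ξ x := by
  rw [hS.leviCivita_deform ha _ (VField.mdiffAt S.ξ x), hS.leviCivita_ξ, S.inner_ξ_right, S.η_ξ]
  simp

theorem IsKenmotsu.leviCivita_deform_deform_ξ [T2Space M] (hS : S.IsKenmotsu) {a : ℝ} (ha : 0 < a)
    (x : M) (v : TangentSpace I x) :
    leviCivita (S.deform a ha).g (S.deform a ha).ξ x v = (1 / a) • (v - S.η x v • S.ξ x) := by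
  have h := (leviCivita (S.deform a ha).g).isCovariantDerivativeOnUniv.smul_const (1 / a)
    (VField.mdiffAt S.ξ x)
  rw [← hS.leviCivita_deform_ξ ha]
  exact congrArg (fun L ↦ L v) h

theorem IsKenmotsu.lieDerivMetric_deform [T2Space M] (hS : S.IsKenmotsu) {a : ℝ} (ha : 0 < a)
    (X Y : VField I M) (x : M) :
    lieDerivMetric (S.deform a ha).g (S.deform a ha).ξ X Y x =
      2 * (S.g.inner x (X x) (Y x) - S.η x (X x) * S.η x (Y x)) := by
  rw [lieDerivMetric_eq _ (VField.mdiffAt _ x) (VField.mdiffAt X x) (VField.mdiffAt Y x),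
    hS.leviCivita_deform_deform_ξ, hS.leviCivita_deform_deform_ξ, deform_inner, deform_inner]
  simp only [map_smul, map_sub, _root_.smul_apply, _root_.sub_apply, smul_eq_mul, S.η_ξ,
    ← S.η_eq, S.inner_ξ_right]
  field_simp
  ring

theorem trace_id_sub_η_smulRight_ξ (S : AlmostContactMetric I M) (x : M) :
    LinearMap.trace ℝ (TangentSpace I x)
      (LinearMap.id - (S.η x).toLinearMap.smulRight (S.ξ x)) = Module.finrank ℝ E - 1 := by
  rw [map_sub, LinearMap.trace_id, LinearMap.trace_smulRight]
  simp only [ContinuousLinearMap.coe_coe, S.η_ξ]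
  rfl

theorem IsKenmotsu.divergence_deform_ξ [T2Space M] (hS : S.IsKenmotsu) {a : ℝ} (ha : 0 < a)
    (x : M) :
    divergence (S.deform a ha).g (S.deform a ha).ξ x = (Module.finrank ℝ E - 1) / a := by
  have h : (leviCivita (S.deform a ha).g (S.deform a ha).ξ x).toLinearMap =
      (1 / a) • (LinearMap.id - (S.η x).toLinearMap.smulRight (S.ξ x)) :=
    LinearMap.ext fun v ↦ hS.leviCivita_deform_deform_ξ ha x v
  rw [divergence, h, map_smul, trace_id_sub_η_smulRight_ξ, smul_eq_mul]
  ring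

/-! ### Divergence, gradient, Hessian and Laplacian -/

/-- The rank-one correction has trace proportional to g(V, ξ) - η(V)η(ξ) = 0. -/
theorem IsKenmotsu.divergence_deform [T2Space M] (hS : S.IsKenmotsu) {a : ℝ} (ha : 0 < a)
    {V : Π x : M, TangentSpace I x} {x : M} (hV : MDiffAt (T% V) x) :
    divergence (S.deform a ha).g V x = divergence S.g V x := by
  have h : (leviCivita (S.deform a ha).g V x).toLinearMap =
      (leviCivita S.g V x).toLinearMap + ((a - 1) / a) •
        ((S.g.inner x (V x) - S.η x (V x) • S.η x).toLinearMap.smulRight (S.ξ x)) := by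
    refine LinearMap.ext fun v ↦ (hS.leviCivita_deform ha v hV).trans ?_
    simp only [LinearMap.add_apply, LinearMap.smul_apply, LinearMap.smulRight_apply,
      ContinuousLinearMap.coe_coe, _root_.sub_apply, _root_.smul_apply, smul_smul, smul_eq_mul,
      S.g.symm x (V x), mul_comm (S.η x (V x))]
  rw [divergence, divergence, h, map_add, map_smul, LinearMap.trace_smulRight]
  simp [S.inner_ξ_right, S.η_ξ]

/-- The gradient of the deformed metric; no regularity of `f` is needed. -/
theorem grad_deform (S : AlmostContactMetric I M) {a : ℝ} (ha : 0 < a) (f : M → ℝ) (x : M) :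
    grad (S.deform a ha).g f x = (1 / a) • grad S.g f x -
      ((a - 1) / a ^ 2 * dirDeriv S.ξ f x) • S.ξ x := by
  refine eq_of_inner (S.deform a ha).g fun Z _ ↦ ?_
  have h : S.η x (grad S.g f x) = dirDeriv S.ξ f x := by
    rw [← S.inner_ξ_right, inner_grad, dirDeriv]
  rw [inner_grad, deform_inner]
  simp only [map_smul, map_sub, _root_.smul_apply, _root_.sub_apply, smul_eq_mul, S.η_ξ, ← S.η_eq,
    inner_grad, h]
  field_simp
  ring

theorem mdiffAt_dirDeriv_ξ (S : AlmostContactMetric I M) {f : M → ℝ}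
    (hf : ContMDiff I 𝓘(ℝ) ∞ f) (x : M) : MDiffAt (dirDeriv S.ξ f) x := by
  rw [dirDeriv_eq_inner_grad S.g]
  exact mdiffAt_inner S.g (mdiffAt_grad S.g hf x) (VField.mdiffAt S.ξ x)

theorem IsKenmotsu.mvfderiv_dirDeriv_ξ [T2Space M] (hS : S.IsKenmotsu) {f : M → ℝ}
    (hf : ContMDiff I 𝓘(ℝ) ∞ f) (x : M) (v : TangentSpace I x) :
    mvfderiv I (dirDeriv S.ξ f) x v = S.η x (leviCivita S.g (grad S.g f) x v) +
      mvfderiv I f x v - S.η x v * dirDeriv S.ξ f x := by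
  rw [dirDeriv_eq_inner_grad S.g, mvfderiv_inner S.g v (mdiffAt_grad S.g hf x)
    (VField.mdiffAt S.ξ x), hS.leviCivita_ξ, S.inner_ξ_right, map_sub, map_smul, inner_grad,
    smul_eq_mul]
  ring

/-- The covariant derivative of the gradient, both for the deformed metric. -/
theorem IsKenmotsu.leviCivita_deform_grad [T2Space M] (hS : S.IsKenmotsu) {a : ℝ} (ha : 0 < a)
    {f : M → ℝ} (hf : ContMDiff I 𝓘(ℝ) ∞ f) (x : M) (v : TangentSpace I x) :
    leviCivita (S.deform a ha).g (grad (S.deform a ha).g f) x v =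
      (1 / a) • leviCivita S.g (grad S.g f) x v -
        ((a - 1) / a ^ 2 * S.η x (leviCivita S.g (grad S.g f) x v)) • S.ξ x -
        ((a - 1) / a ^ 2 * dirDeriv S.ξ f x) • (v - S.η x v • S.ξ x) := by
  have hG := mdiffAt_grad S.g hf x
  have hξ := VField.mdiffAt S.ξ x
  have hd := S.mdiffAt_dirDeriv_ξ hf x
  have hcov := (leviCivita (S.deform a ha).g).isCovariantDerivativeOnUniv
  -- Written as a sum of sections, with ξ(f) as a function multiplying ξ, to suit additivity and the
  -- Leibniz rule.
  have hgrad : grad (S.deform a ha).g f =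
      (1 / a) • grad S.g f + (-((a - 1) / a ^ 2)) • (dirDeriv S.ξ f • (S.ξ : Π x, _)) := by
    funext y
    rw [S.grad_deform]
    simp only [Pi.add_apply, Pi.smul_apply, Pi.smul_apply']
    module
  have hη : S.η x (grad S.g f x) = dirDeriv S.ξ f x := by
    rw [← S.inner_ξ_right, inner_grad, dirDeriv]
  have hs := hd.smul_section hξ
  have hadd := hcov.add (x := x) (hG.smul_const_section (a := 1 / a))
    (hs.smul_const_section (a := -((a - 1) / a ^ 2)))
  rw [hgrad]
  refine (congrArg (fun L ↦ L v) hadd).trans ?_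
  rw [hcov.smul_const _ hG, hcov.smul_const _ hs, hcov.leibniz hξ hd]
  simp only [_root_.add_apply, _root_.smul_apply, ContinuousLinearMap.smulRight_apply]
  -- The connection's correction on grad f contributes (a - 1)/a² (v(f) - η(v)ξ(f)) ξ, which cancels
  -- the same terms coming from the derivative of ξ(f).
  rw [hS.leviCivita_deform_ξ ha, hS.leviCivita_deform ha _ hG, hS.mvfderiv_dirDeriv_ξ hf,
    S.g.symm x v, inner_grad, hη]
  match_scalars
  · field_simp
  · field_simp
    ring
  · field_simp

/-- With A = ∇_v grad f, the η ⊗ η part of the deformed metric on A/a cancels the η(A) ξ term; the I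
- η ⊗ ξ term gives the correction. -/
theorem IsKenmotsu.hessian_deform [T2Space M] (hS : S.IsKenmotsu) {a : ℝ} (ha : 0 < a)
    {f : M → ℝ} (hf : ContMDiff I 𝓘(ℝ) ∞ f) (x : M) (v w : TangentSpace I x) :
    hessian (S.deform a ha).g f x v w = hessian S.g f x v w -
      (a - 1) / a * dirDeriv S.ξ f x * (S.g.inner x v w - S.η x v * S.η x w) := by
  rw [hessian, hessian, hS.leviCivita_deform_grad ha hf, deform_inner]
  simp only [map_smul, map_sub, _root_.smul_apply, _root_.sub_apply, smul_eq_mul, S.η_ξ, ← S.η_eq]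
  field_simp
  ring

theorem IsKenmotsu.laplacian_deform [T2Space M] (hS : S.IsKenmotsu) {a : ℝ} (ha : 0 < a)
    {f : M → ℝ} (hf : ContMDiff I 𝓘(ℝ) ∞ f) (x : M) :
    laplacian (S.deform a ha).g f x = (1 / a) * laplacian S.g f x -
      (Module.finrank ℝ E - 1) * (a - 1) / a ^ 2 * dirDeriv S.ξ f x -
      (a - 1) / a ^ 2 * dirDeriv S.ξ (dirDeriv S.ξ f) x := by
  have h : (leviCivita (S.deform a ha).g (grad (S.deform a ha).g f) x).toLinearMap =
      (1 / a) • (leviCivita S.g (grad S.g f) x).toLinearMap -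
        ((a - 1) / a ^ 2) •
          ((S.η x).toLinearMap ∘ₗ (leviCivita S.g (grad S.g f) x).toLinearMap).smulRight (S.ξ x) -
        ((a - 1) / a ^ 2 * dirDeriv S.ξ f x) •
          (LinearMap.id - (S.η x).toLinearMap.smulRight (S.ξ x)) := by
    refine LinearMap.ext fun v ↦ (hS.leviCivita_deform_grad ha hf x v).trans ?_
    simp [smul_smul]
  -- Reflects ∇_ξ ξ = 0: the two ξ(f) terms cancel at v = ξ. This identifies the trace of the
  -- rank-one map built from η and ∇ grad f.
  have h2 : dirDeriv S.ξ (dirDeriv S.ξ f) x =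
      S.η x (leviCivita S.g (grad S.g f) x (S.ξ x)) := by
    rw [dirDeriv, hS.mvfderiv_dirDeriv_ξ hf, S.η_ξ, dirDeriv]
    ring
  rw [laplacian, laplacian, divergence, divergence, h, h2, map_sub, map_sub, map_smul, map_smul,
    map_smul, trace_id_sub_η_smulRight_ξ, LinearMap.trace_smulRight]
  simp only [smul_eq_mul, LinearMap.comp_apply, ContinuousLinearMap.coe_coe]
  ring

end AlmostContactMetric

end ContactGeom

/-! ### Specialization to dimension 2n + 1 -/

theorem mainTheorem11 (n : ℕ) {M : Type*} [TopologicalSpace M] [T2Space M]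
    [ChartedSpace (EuclideanSpace ℝ (Fin (2 * n + 1))) M] [IsManifold (𝓡 (2 * n + 1)) ∞ M]
    (S : ContactGeom.AlmostContactMetric (𝓡 (2 * n + 1)) M) (hS : S.IsKenmotsu)
    (a : ℝ) (ha : 0 < a) :
    -- the covariant derivative of the deformed `φ`
    (∀ (X Y : ContactGeom.VField (𝓡 (2 * n + 1)) M) (x : M),
      ContactGeom.covDerivEnd (S.deform a ha).g (S.deform a ha).φ X Y x =
        ((1 / a) * S.g.inner x (S.φ x (X x)) (Y x)) • S.ξ x - S.η x (Y x) • S.φ x (X x)) ∧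
    -- the covariant derivative of the deformed `ξ`
    (∀ (x : M) (v : TangentSpace (𝓡 (2 * n + 1)) x),
      ContactGeom.leviCivita (S.deform a ha).g (S.deform a ha).ξ x v = (1 / a) • (v - S.η x v • S.ξ x)) ∧
    -- the Lie derivative of the deformed metric along the deformed `ξ`
    (∀ (X Y : ContactGeom.VField (𝓡 (2 * n + 1)) M) (x : M),
      ContactGeom.lieDerivMetric (S.deform a ha).g (S.deform a ha).ξ X Y x =
        2 * (S.g.inner x (X x) (Y x) - S.η x (X x) * S.η x (Y x))) ∧
    -- the divergence of the deformed `ξ`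
    (∀ x : M, ContactGeom.divergence (S.deform a ha).g (S.deform a ha).ξ x = 2 * n / a) ∧
    -- the Hessian
    (∀ f : M → ℝ, ContMDiff (𝓡 (2 * n + 1)) 𝓘(ℝ) ∞ f →
      ∀ (x : M) (v w : TangentSpace (𝓡 (2 * n + 1)) x),
        ContactGeom.hessian (S.deform a ha).g f x v w =
          ContactGeom.hessian S.g f x v w -
            (a - 1) / a * ContactGeom.dirDeriv S.ξ f x *
              (S.g.inner x v w - S.η x v * S.η x w)) ∧
    -- the gradient
    (∀ f : M → ℝ, ContMDiff (𝓡 (2 * n + 1)) 𝓘(ℝ) ∞ f → ∀ x : M,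
      ContactGeom.grad (S.deform a ha).g f x =
        (1 / a) • ContactGeom.grad S.g f x -
          ((a - 1) / a ^ 2 * ContactGeom.dirDeriv S.ξ f x) • S.ξ x) ∧
    -- the divergence
    (∀ (V : ContactGeom.VField (𝓡 (2 * n + 1)) M) (x : M),
      ContactGeom.divergence (S.deform a ha).g V x = ContactGeom.divergence S.g V x) ∧
    -- the Laplace operator
    (∀ f : M → ℝ, ContMDiff (𝓡 (2 * n + 1)) 𝓘(ℝ) ∞ f → ∀ x : M,
      ContactGeom.laplacian (S.deform a ha).g f x =
        (1 / a) * ContactGeom.laplacian S.g f x -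
          2 * n * (a - 1) / a ^ 2 * ContactGeom.dirDeriv S.ξ f x -
          (a - 1) / a ^ 2 *
            ContactGeom.dirDeriv S.ξ (ContactGeom.dirDeriv S.ξ f) x) := by
  have hn : (Module.finrank ℝ (EuclideanSpace ℝ (Fin (2 * n + 1))) : ℝ) - 1 = 2 * n := by
    simp
  refine ⟨hS.covDerivEnd_deform ha, hS.leviCivita_deform_deform_ξ ha, hS.lieDerivMetric_deform ha,
    fun x ↦ ?_, fun f hf ↦ hS.hessian_deform ha hf, fun f _ ↦ S.grad_deform ha f,
    fun V x ↦ hS.divergence_deform ha (ContactGeom.VField.mdiffAt V x), fun f hf x ↦ ?_⟩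
  · rw [hS.divergence_deform_ξ ha, hn]
  · rw [hS.laplacian_deform ha hf, hn]
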